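/- Let $\mathfrak M$ be a complex Hilbert space; a linear relation in $\mathfrak M$ is a linear subspace of $\mathfrak M\times\mathfrak M$, bounded operators are identified with their graphs, and inverses, sums and scalar multiples are those of linear relations: $A^{-1}=\{\{f',f\}:\{f,f'\}\in A\}$, $A+B=\{\{f,g+k\}:\{f,g\}\in A,\{f,k\}\in B\}$, $cA=\{\{f,cf'\}:\{f,f'\}\in A\}$. A *Nevanlinna family* is a family $\mathcal M(\lambda)$, $\lambda\in\mathbb C\setminus\mathbb R$, of linear relations in $\mathfrak M$ such that $\mathcal M(\lambda)$ is maximal dissipative ($\operatorname{Im}(f',f)\ge0$ for $\{f,f'\}\in\mathcal M(\lambda)$) for $\lambda\in\mathbb C_+$ and maximal accumulative for $\lambda\in\mathbb C_-$; $\mathcal M(\lambda)^*=\mathcal M(\bar\lambda)$; and for some $\mu\in\mathbb C_+$ (resp. $\mathbb C_-$) the function $(\mathcal M(\lambda)+\mu)^{-1}$ has values in $\mathbf B(\mathfrak M)$ and is holomorphic on $\mathbb C_+$ (resp. $\mathbb C_-$). A family $\mathcal M(\lambda)$, $\lambda\in\mathbb C\setminus[0,\infty)$, is a *Stieltjes family*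 (resp. *inverse Stieltjes family*) if it is a Nevanlinna family, $(f',f)\ge0$ (resp. $\le0$) for all $\{f,f'\}\in\mathcal M(x)$ and $x<0$, and for some $\mu\in\mathbb C_+$ (resp. $\mathbb C_-$) the function $(\mathcal M(\lambda)+\mu)^{-1}$ on $\mathbb C_+$ (resp. $\mathbb C_-$) has an analytic continuation to $(-\infty,0)$ whose value at each $x<0$ is $(\mathcal M(x)+\mu)^{-1}\in\mathbf B(\mathfrak M)$. The class $\mathcal{RS}(\mathfrak M)$ consists of the $\mathbf B(\mathfrak M)$-valued Nevanlinna functions $\Omega$ that are holomorphic on $D=\mathbb C\setminus((-\infty,-1]\cup[1,\infty))$ and satisfy $-I\le\Omega(x)\le I$ for $x\in(-1,1)$. For a function $\Omega:D\to\mathbf B(\mathfrak M)$ and $\lambda\in\mathbb C\setminus[0,\infty)$ put $$\mathcal Q_\Omega(\lambda)=-I+2\Big(I-\Omega\big(\tfrac{1+\lambda}{1-\lambda}\big)\Big)^{-1},\qquad \mathcal R_\Omega(\lambda)=I-2\Big(I+\Omega\big(\tfrac{1+\lambda}{1-\lambda}\big)\Big)^{-1}.$$ Then: 1. With $z=\frac{1+\lambda}{1-\lambda}$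 one has $\mathcal Q_\Omega(\lambda)=\{\{(I-\Omega(z))h,(I+\Omega(z))h\}:h\in\mathfrak M\}$, $\mathcal R_\Omega(\lambda)=\{\{(I+\Omega(z))h,(\Omega(z)-I)h\}:h\in\mathfrak M\}$ and $\mathcal R_\Omega(\lambda)=-\mathcal Q_\Omega(\lambda)^{-1}$. 2. $\Omega\in\mathcal{RS}(\mathfrak M)$ if and only if $\mathcal Q_\Omega$ is a Stieltjes family, and if and only if $\mathcal R_\Omega$ is an inverse Stieltjes family. 3. For every Stieltjes family $\mathcal Q$ (resp. inverse Stieltjes family $\mathcal R$) in $\mathfrak M$ there is $\Omega\in\mathcal{RS}(\mathfrak M)$ with $\mathcal Q=\mathcal Q_\Omega$ (resp. $\mathcal R=\mathcal R_\Omega$) on $\mathbb C\setminus[0,\infty)$. 4. A family $\mathcal Q$ of linear relations in $\mathfrak M$ is a Stieltjes family if and only if $-\mathcal Q^{-1}$ is an inverse Stieltjes family. -/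

import Mathlib

noncomputable section

/-- A linear relation in `M`: a linear subspace of `M × M`, whose elements are the pairs
`{f, f'}`. -/
abbrev LinRel (M : Type*) [NormedAddCommGroup M] [InnerProductSpace ℂ M] : Type _ :=
  Submodule ℂ (M × M)

namespace LinRel

variable {M : Type*} [NormedAddCommGroup M] [InnerProductSpace ℂ M]

/-- A bounded operator regarded as a linear relation, namely its graph. -/
def ofOp (T : M →L[ℂ] M) : LinRel M := LinearMap.graph (T : M →ₗ[ℂ] M)

/-- The inverse relation `{ {f', f} : {f, f'} ∈ A }`. -/
def inv (A : LinRel M) : LinRel M where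
  carrier := {p | (p.2, p.1) ∈ A}
  add_mem' := fun ha hb => A.add_mem ha hb
  zero_mem' := A.zero_mem
  smul_mem' := fun c _ ha => A.smul_mem c ha

/-- The scalar multiple `{ {f, c f'} : {f, f'} ∈ A }`. -/
def smul (c : ℂ) (A : LinRel M) : LinRel M where
  carrier := {p | ∃ g, (p.1, g) ∈ A ∧ p.2 = c • g}
  add_mem' := by
    rintro _ _ ⟨g, hg, h1⟩ ⟨k, hk, h2⟩
    exact ⟨g + k, A.add_mem hg hk, by simp [h1, h2]⟩
  zero_mem' := ⟨0, A.zero_mem, by simp⟩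
  smul_mem' := by
    rintro a _ ⟨g, hg, h1⟩
    exact ⟨a • g, A.smul_mem a hg, by simp [h1, smul_comm a c g]⟩

/-- The operator-like sum `{ {f, g + k} : {f, g} ∈ A, {f, k} ∈ B }`. -/
def add (A B : LinRel M) : LinRel M where
  carrier := {p | ∃ g k, (p.1, g) ∈ A ∧ (p.1, k) ∈ B ∧ p.2 = g + k}
  add_mem' := by
    rintro _ _ ⟨g, k, hg, hk, h1⟩ ⟨g', k', hg', hk', h2⟩
    exact ⟨g + g', k + k', A.add_mem hg hg', B.add_mem hk hk', by
      simp [h1, h2, add_add_add_comm]⟩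
  zero_mem' := ⟨0, 0, A.zero_mem, B.zero_mem, by simp⟩
  smul_mem' := by
    rintro a _ ⟨g, k, hg, hk, h1⟩
    exact ⟨a • g, a • k, A.smul_mem a hg, B.smul_mem a hk, by simp [h1]⟩

/-- `-A`. -/
def neg (A : LinRel M) : LinRel M := smul (-1) A

/-- `(A + μ)⁻¹`, a linear relation in general. -/
def shiftInv (A : LinRel M) (μ : ℂ) : LinRel M := inv (add A (ofOp (μ • 1)))

/-- `Im (f', f) ≥ 0` for all `{f, f'} ∈ A`; Mathlib's inner product is conjugate-linear in its
first argument, so that `(f', f)` is `inner ℂ f f'`. -/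
def IsDissipative (A : LinRel M) : Prop := ∀ p ∈ A, 0 ≤ (inner ℂ p.1 p.2).im

/-- `Im (f', f) ≤ 0` for all `{f, f'} ∈ A`. -/
def IsAccumulative (A : LinRel M) : Prop := ∀ p ∈ A, (inner ℂ p.1 p.2).im ≤ 0

/-- `(f', f) ≥ 0` for all `{f, f'} ∈ A`. -/
def IsNonneg (A : LinRel M) : Prop :=
  ∀ p ∈ A, (inner ℂ p.1 p.2).im = 0 ∧ 0 ≤ (inner ℂ p.1 p.2).re

/-- `(f', f) ≤ 0` for all `{f, f'} ∈ A`. -/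
def IsNonpos (A : LinRel M) : Prop :=
  ∀ p ∈ A, (inner ℂ p.1 p.2).im = 0 ∧ (inner ℂ p.1 p.2).re ≤ 0

end LinRel

section Families

variable {M : Type*} [NormedAddCommGroup M] [InnerProductSpace ℂ M]

/-- The open upper half-plane. -/
def upperHalf : Set ℂ := {z | 0 < z.im}

/-- The open lower half-plane. -/
def lowerHalf : Set ℂ := {z | z.im < 0}

/-- The open negative half-axis `(-∞, 0)`. -/
def negAxis : Set ℂ := {z | z.im = 0 ∧ z.re < 0}

/-- `ℂ \ [0, ∞)`. -/
def cutPlane : Set ℂ := {z | ¬(z.im = 0 ∧ 0 ≤ z.re)}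

/-- `ℂ \ ((-∞, -1] ∪ [1, ∞))`. -/
def doublyCutPlane : Set ℂ := {z | ¬(z.im = 0 ∧ (z.re ≤ -1 ∨ 1 ≤ z.re))}

/-- For every `l ∈ S` the relation `(𝓜(l) + μ)⁻¹` is (the graph of) an everywhere defined bounded
operator `F l`, and `F` is analytic at every point of `S`. If `S` is open, this says that
`(𝓜(l) + μ)⁻¹` is a holomorphic operator function on `S`; if `S` is a half-plane together with a
piece of its boundary, it says moreover that this function has an analytic continuation across
that piece, whose values there are `(𝓜(l) + μ)⁻¹`. -/
def ResolventAnalyticOn (𝓜 : ℂ → LinRel M) (μ : ℂ) (S : Set ℂ) : Prop :=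
  ∃ F : ℂ → M →L[ℂ] M, AnalyticOnNhd ℂ F S ∧
    ∀ l ∈ S, LinRel.shiftInv (𝓜 l) μ = LinRel.ofOp (F l)

/-- Nevanlinna families. Only the values of `𝓜` on `ℂ \ ℝ` matter. -/
structure IsNevanlinnaFamily [CompleteSpace M] (𝓜 : ℂ → LinRel M) : Prop where
  dissipative : ∀ l ∈ upperHalf, Maximal LinRel.IsDissipative (𝓜 l)
  accumulative : ∀ l ∈ lowerHalf, Maximal LinRel.IsAccumulative (𝓜 l)
  adjoint_eq : ∀ l : ℂ, l.im ≠ 0 → (𝓜 l).adjoint = 𝓜 (starRingEnd ℂ l)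
  holomorphic_upper : ∃ μ ∈ upperHalf, ResolventAnalyticOn 𝓜 μ upperHalf
  holomorphic_lower : ∃ μ ∈ lowerHalf, ResolventAnalyticOn 𝓜 μ lowerHalf

/-- Stieltjes families. Only the values of `𝓜` on `ℂ \ [0, ∞)` matter. -/
structure IsStieltjesFamily [CompleteSpace M] (𝓜 : ℂ → LinRel M) : Prop where
  nevanlinna : IsNevanlinnaFamily 𝓜
  nonneg : ∀ x ∈ negAxis, LinRel.IsNonneg (𝓜 x)
  continuation_upper : ∃ μ ∈ upperHalf, ResolventAnalyticOn 𝓜 μ (upperHalf ∪ negAxis)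
  continuation_lower : ∃ μ ∈ lowerHalf, ResolventAnalyticOn 𝓜 μ (lowerHalf ∪ negAxis)

/-- Inverse Stieltjes families. Only the values of `𝓜` on `ℂ \ [0, ∞)` matter. -/
structure IsInverseStieltjesFamily [CompleteSpace M] (𝓜 : ℂ → LinRel M) : Prop where
  nevanlinna : IsNevanlinnaFamily 𝓜
  nonpos : ∀ x ∈ negAxis, LinRel.IsNonpos (𝓜 x)
  continuation_upper : ∃ μ ∈ upperHalf, ResolventAnalyticOn 𝓜 μ (upperHalf ∪ negAxis)
  continuation_lower : ∃ μ ∈ lowerHalf, ResolventAnalyticOn 𝓜 μ (lowerHalf ∪ negAxis)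

/-- The combined Nevanlinna-Schur class: bounded-operator-valued Nevanlinna functions that are
holomorphic on `ℂ \ ((-∞, -1] ∪ [1, ∞))` and satisfy `-I ≤ Ω(x) ≤ I` on `(-1, 1)`. Only the values
of `Ω` on `ℂ \ ((-∞, -1] ∪ [1, ∞))` matter. -/
structure IsNevanlinnaSchur [CompleteSpace M] (Ω : ℂ → M →L[ℂ] M) : Prop where
  nevanlinna : IsNevanlinnaFamily fun z => LinRel.ofOp (Ω z)
  holomorphic : DifferentiableOn ℂ Ω doublyCutPlane
  bounds : ∀ x : ℝ, -1 < x → x < 1 → -1 ≤ Ω (x : ℂ) ∧ Ω (x : ℂ) ≤ 1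

/-- `𝒬(l) = -I + 2 (I - Ω((1 + l)/(1 - l)))⁻¹`, in the sense of linear relations. -/
def stieltjesTransform (Ω : ℂ → M →L[ℂ] M) (l : ℂ) : LinRel M :=
  LinRel.add (LinRel.ofOp (-1))
    (LinRel.smul 2 (LinRel.inv (LinRel.ofOp (1 - Ω ((1 + l) / (1 - l))))))

/-- `ℛ(l) = I - 2 (I + Ω((1 + l)/(1 - l)))⁻¹`, in the sense of linear relations. -/
def inverseStieltjesTransform (Ω : ℂ → M →L[ℂ] M) (l : ℂ) : LinRel M :=
  LinRel.add (LinRel.ofOp 1)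
    (LinRel.neg (LinRel.smul 2 (LinRel.inv (LinRel.ofOp (1 + Ω ((1 + l) / (1 - l)))))))

end Families

end

/-!
In the variable `z = (1 + l) / (1 - l)`, the transform `𝒬_Ω(l)` is the image of the graph of `Ω(z)`
under the linear automorphism `(f, f') ↦ (f - f', f + f')` of `M × M`, a Cayley transform. It
multiplies the boundary form `⟪f', g⟫ - ⟪f, g'⟫` by `2`, hence respects dissipativity, maximality
and adjoints, and `Re ⟪f - f', f + f'⟫ = ‖f‖² - ‖f'‖²` turns selfadjoint contractions into
nonnegative relations. In the same way `ℛ_Ω = -𝒬_Ω⁻¹` is the image of `𝒬_Ω` under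
`(f, f') ↦ (-f', f)`, which preserves the boundary form.

Conversely, a Stieltjes family `𝒬` comes from a function `Ω` as soon as `-1` is a regular point of
all its values. With `F = (𝒬 + μ)⁻¹` this says that `1 + (1 - μ) F(l)` is invertible. On `(-∞, 0)`
it is, because `𝒬(l) ≥ 0`. On the upper half-plane a scalar multiple of it is within distance `1`
of the identity, so its quadratic forms are holomorphic with nonnegative real part, and Harnack's
inequality spreads invertibility from points near `-1` to the whole half-plane.
-/

open scoped ComplexConjugate ComplexOrder Topology

open Filter LinRel

theorem maximal_orderIso_apply_iff {α β : Type*} [Preorder α] [Preorder β] (e : α ≃o β)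
    {P : α → Prop} {Q : β → Prop} (h : ∀ a, Q (e a) ↔ P a) (a : α) :
    Maximal Q (e a) ↔ Maximal P a := by
  simp only [Maximal, e.surjective.forall, h, e.le_iff_le]

namespace LinRel

variable {M : Type*} [NormedAddCommGroup M] [InnerProductSpace ℂ M]

theorem mem_ofOp {T : M →L[ℂ] M} {p : M × M} : p ∈ ofOp T ↔ p.2 = T p.1 :=
  LinearMap.mem_graph_iff _ _

theorem ofOp_injective : Function.Injective (ofOp : (M →L[ℂ] M) → LinRel M) := by
  intro S T h
  ext x
  have hx : (x, S x) ∈ ofOp T := h ▸ mem_ofOp.2 rfl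
  exact mem_ofOp.1 hx

theorem mem_inv {A : LinRel M} {p : M × M} : p ∈ inv A ↔ (p.2, p.1) ∈ A := Iff.rfl

theorem mem_smul {c : ℂ} (hc : c ≠ 0) {A : LinRel M} {p : M × M} :
    p ∈ smul c A ↔ (p.1, c⁻¹ • p.2) ∈ A := by
  constructor
  · rintro ⟨g, hg, hp⟩
    rwa [hp, inv_smul_smul₀ hc]
  · exact fun hp => ⟨_, hp, (smul_inv_smul₀ hc _).symm⟩

theorem mem_add_ofOp {A : LinRel M} {T : M →L[ℂ] M} {p : M × M} :
    p ∈ add A (ofOp T) ↔ (p.1, p.2 - T p.1) ∈ A := by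
  constructor
  · rintro ⟨g, k, hg, hk, hp⟩
    rwa [hp, show k = T p.1 from mem_ofOp.1 hk, add_sub_cancel_right]
  · exact fun hp => ⟨_, _, hp, mem_ofOp.2 rfl, (sub_add_cancel _ _).symm⟩

protected theorem add_comm (A B : LinRel M) : add A B = add B A := by
  ext p
  constructor <;>
  · rintro ⟨g, k, hg, hk, hp⟩
    exact ⟨k, g, hk, hg, hp.trans (_root_.add_comm g k)⟩

theorem mem_neg_inv {A : LinRel M} {p : M × M} : p ∈ neg (inv A) ↔ (-p.2, p.1) ∈ A := by
  rw [neg, mem_smul (by norm_num), mem_inv, inv_neg_one, neg_one_smul]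

theorem shiftInv_eq_ofOp_iff {A : LinRel M} {μ : ℂ} {F : M →L[ℂ] M} :
    shiftInv A μ = ofOp F ↔ ∀ f f', (f, f') ∈ A ↔ F (f' + μ • f) = f := by
  have mem_shiftInv (g f : M) : (g, f) ∈ shiftInv A μ ↔ (f, g - μ • f) ∈ A := by
    rw [shiftInv, mem_inv, mem_add_ofOp]
    rfl
  constructor
  · intro h f f'
    rw [← add_sub_cancel_right f' (μ • f), ← mem_shiftInv, h, mem_ofOp, sub_add_cancel, eq_comm]
  · intro h
    ext ⟨g, f⟩
    rw [mem_shiftInv, h, mem_ofOp, sub_add_cancel, eq_comm]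

/-! ### Similitudes of the boundary form -/

/-- The sesquilinear form `(f, g') - (f', g)` of Green's identity, in Mathlib's order of the
arguments. It determines dissipativity, accumulativity and the adjoint, which are therefore
transported by every linear automorphism of `M × M` that multiplies it by a positive number. -/
noncomputable def boundaryForm (p q : M × M) : ℂ := inner ℂ p.2 q.1 - inner ℂ p.1 q.2

theorem boundaryForm_self_im (p : M × M) : (boundaryForm p p).im = -2 * (inner ℂ p.1 p.2).im := by
  rw [boundaryForm, ← inner_conj_symm, Complex.sub_im, Complex.conj_im]
  ring

theorem mem_adjoint_iff_boundaryForm {A : LinRel M} {q : M × M} :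
    q ∈ A.adjoint ↔ ∀ p ∈ A, boundaryForm p q = 0 := by
  rw [Submodule.mem_adjoint_iff, Prod.forall]
  rfl

section Similitude

variable {e : (M × M) ≃ₗ[ℂ] M × M} {c : ℝ}

theorem inner_im_of_boundaryForm_apply
    (he : ∀ p q, boundaryForm (e p) (e q) = c * boundaryForm p q) (p : M × M) :
    (inner ℂ (e p).1 (e p).2).im = c * (inner ℂ p.1 p.2).im := by
  have h := congrArg Complex.im (he p p)
  rw [Complex.im_ofReal_mul, boundaryForm_self_im, boundaryForm_self_im] at h
  linarith

theorem forall_mem_orderIsoMapComap {A : LinRel M} {P : M × M → Prop} :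
    (∀ p ∈ Submodule.orderIsoMapComap e A, P p) ↔ ∀ p ∈ A, P (e p) := by
  simp only [Submodule.orderIsoMapComap_apply, Submodule.mem_map, LinearEquiv.coe_coe,
    forall_exists_index, and_imp, forall_apply_eq_imp_iff₂]

theorem isDissipative_orderIsoMapComap (hc : 0 < c)
    (he : ∀ p q, boundaryForm (e p) (e q) = c * boundaryForm p q) (A : LinRel M) :
    IsDissipative (Submodule.orderIsoMapComap e A) ↔ IsDissipative A := by
  simp only [IsDissipative, forall_mem_orderIsoMapComap, inner_im_of_boundaryForm_apply he,
    mul_nonneg_iff_of_pos_left hc]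

theorem isAccumulative_orderIsoMapComap (hc : 0 < c)
    (he : ∀ p q, boundaryForm (e p) (e q) = c * boundaryForm p q) (A : LinRel M) :
    IsAccumulative (Submodule.orderIsoMapComap e A) ↔ IsAccumulative A := by
  simp only [IsAccumulative, forall_mem_orderIsoMapComap, inner_im_of_boundaryForm_apply he,
    ← not_lt, mul_pos_iff_of_pos_left hc]

theorem adjoint_orderIsoMapComap (hc : c ≠ 0)
    (he : ∀ p q, boundaryForm (e p) (e q) = c * boundaryForm p q) (A : LinRel M) :
    (Submodule.orderIsoMapComap e A).adjoint = Submodule.orderIsoMapComap e A.adjoint := by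
  ext q
  obtain ⟨q, rfl⟩ := e.surjective q
  rw [mem_adjoint_iff_boundaryForm, forall_mem_orderIsoMapComap,
    Submodule.orderIsoMapComap_apply, Submodule.mem_map_equiv, e.symm_apply_apply,
    mem_adjoint_iff_boundaryForm]
  simp only [he, mul_eq_zero, Complex.ofReal_eq_zero, hc, false_or]

end Similitude

/-! ### The involution `A ↦ -A⁻¹` -/

/-- The involution `A ↦ -A⁻¹`, as an automorphism of the lattice of linear relations. -/
def negInv : LinRel M ≃o LinRel M := Submodule.orderIsoMapComap (LinearEquiv.skewSwap ℂ M M)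

theorem mem_negInv {A : LinRel M} {p : M × M} : p ∈ negInv A ↔ (p.2, -p.1) ∈ A :=
  Submodule.mem_map_equiv A

theorem negInv_eq_neg_inv (A : LinRel M) : negInv A = neg (inv A) := by
  ext p
  rw [mem_negInv, mem_neg_inv, ← neg_mem_iff]
  simp

theorem negInv_negInv (A : LinRel M) : negInv (negInv A) = A := by
  ext p
  rw [mem_negInv, mem_negInv, ← neg_mem_iff]
  simp

theorem boundaryForm_skewSwap (p q : M × M) :
    boundaryForm (LinearEquiv.skewSwap ℂ M M p) (LinearEquiv.skewSwap ℂ M M q) =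
      (1 : ℝ) * boundaryForm p q := by
  simp only [boundaryForm, LinearEquiv.skewSwap_apply, inner_neg_left, inner_neg_right]
  push_cast
  ring

theorem isDissipative_negInv (A : LinRel M) : IsDissipative (negInv A) ↔ IsDissipative A :=
  isDissipative_orderIsoMapComap one_pos boundaryForm_skewSwap A

theorem isAccumulative_negInv (A : LinRel M) : IsAccumulative (negInv A) ↔ IsAccumulative A :=
  isAccumulative_orderIsoMapComap one_pos boundaryForm_skewSwap A

theorem adjoint_negInv (A : LinRel M) : (negInv A).adjoint = negInv A.adjoint :=
  adjoint_orderIsoMapComap one_ne_zero boundaryForm_skewSwap A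

theorem isNonpos_negInv (A : LinRel M) : IsNonpos (negInv A) ↔ IsNonneg A := by
  have inner_skewSwap (p : M × M) : inner ℂ (-p.2) p.1 = -conj (inner ℂ p.1 p.2) := by
    rw [inner_neg_left, inner_conj_symm]
  simp only [IsNonpos, negInv, forall_mem_orderIsoMapComap, LinearEquiv.skewSwap_apply,
    inner_skewSwap]
  simp [IsNonneg, -inner_conj_symm]

theorem isNonneg_negInv (A : LinRel M) : IsNonneg (negInv A) ↔ IsNonpos A := by
  rw [← isNonpos_negInv, negInv_negInv]

theorem shiftInv_negInv {A : LinRel M} {μ : ℂ} {F : M →L[ℂ] M} (hμ : μ ≠ 0)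
    (h : shiftInv A μ = ofOp F) :
    shiftInv (negInv A) (-μ⁻¹) = ofOp (-μ • (1 - μ • F)) := by
  rw [shiftInv_eq_ofOp_iff] at h ⊢
  intro f f'
  have arg_eq : f' + -μ⁻¹ • f = μ⁻¹ • (-f + μ • f') := by
    match_scalars <;> field_simp
  rw [mem_negInv, h, arg_eq]
  simp only [smul_apply, sub_apply, map_smul, one_apply_eq_self]
  generalize F (-f + μ • f') = y
  have value_eq : μ⁻¹ • -μ • (-f + μ • f' - μ • y) = f + μ • (y - f') := by
    match_scalars <;> field_simp
  rw [value_eq, add_eq_left, smul_eq_zero, or_iff_right hμ, sub_eq_zero]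

/-! ### The Cayley transform -/

/-- The automorphism `{h, k} ↦ {h - k, h + k}` of `M × M`. -/
@[simps]
noncomputable def cayleyEquiv (M : Type*) [NormedAddCommGroup M] [InnerProductSpace ℂ M] :
    (M × M) ≃ₗ[ℂ] M × M where
  toFun p := (p.1 - p.2, p.1 + p.2)
  invFun p := ((2 : ℂ)⁻¹ • (p.1 + p.2), (2 : ℂ)⁻¹ • (p.2 - p.1))
  map_add' p q := by ext <;> simp only [Prod.fst_add, Prod.snd_add] <;> abel
  map_smul' c p := by simp [smul_sub]
  left_inv p := by ext <;> dsimp only <;> module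
  right_inv p := by ext <;> dsimp only <;> module

/-- The Cayley transform `A ↦ { {h - k, h + k} : {h, k} ∈ A }`, as an automorphism of the lattice
of linear relations. For an operator `T` it is `-I + 2 (I - T)⁻¹`. -/
noncomputable def cayley : LinRel M ≃o LinRel M := Submodule.orderIsoMapComap (cayleyEquiv M)

theorem mem_cayley_ofOp {T : M →L[ℂ] M} {p : M × M} :
    p ∈ cayley (ofOp T) ↔ p.2 - p.1 = T (p.1 + p.2) := by
  rw [cayley, Submodule.orderIsoMapComap_apply, Submodule.mem_map_equiv, mem_ofOp,
    cayleyEquiv_symm_apply, map_smul]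
  exact smul_right_inj (by norm_num)

theorem mem_cayley_ofOp_iff_exists {T : M →L[ℂ] M} {p : M × M} :
    p ∈ cayley (ofOp T) ↔ ∃ h, p = ((1 - T) h, (1 + T) h) := by
  simp only [cayley, Submodule.orderIsoMapComap_apply, Submodule.mem_map, Prod.exists, mem_ofOp,
    exists_eq_left, eq_comm (a := p)]
  rfl

theorem boundaryForm_cayleyEquiv (p q : M × M) :
    boundaryForm (cayleyEquiv M p) (cayleyEquiv M q) = (2 : ℝ) * boundaryForm p q := by
  simp only [boundaryForm, cayleyEquiv_apply, inner_add_left, inner_sub_left, inner_add_right,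
    inner_sub_right]
  push_cast
  ring

theorem isDissipative_cayley (A : LinRel M) : IsDissipative (cayley A) ↔ IsDissipative A :=
  isDissipative_orderIsoMapComap two_pos boundaryForm_cayleyEquiv A

theorem isAccumulative_cayley (A : LinRel M) : IsAccumulative (cayley A) ↔ IsAccumulative A :=
  isAccumulative_orderIsoMapComap two_pos boundaryForm_cayleyEquiv A

theorem adjoint_cayley (A : LinRel M) : (cayley A).adjoint = cayley A.adjoint :=
  adjoint_orderIsoMapComap two_ne_zero boundaryForm_cayleyEquiv A

theorem inner_cayleyEquiv_re (p : M × M) :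
    (inner ℂ (cayleyEquiv M p).1 (cayleyEquiv M p).2).re = ‖p.1‖ ^ 2 - ‖p.2‖ ^ 2 := by
  simp only [cayleyEquiv_apply, inner_sub_left, inner_add_right, Complex.sub_re, Complex.add_re]
  rw [← inner_conj_symm p.2 p.1, Complex.conj_re]
  have inner_fst := inner_self_eq_norm_sq (𝕜 := ℂ) p.1
  have inner_snd := inner_self_eq_norm_sq (𝕜 := ℂ) p.2
  simp only [RCLike.re_to_complex] at inner_fst inner_snd
  rw [inner_fst, inner_snd]
  ring

theorem isNonneg_cayley_ofOp (T : M →L[ℂ] M) :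
    IsNonneg (cayley (ofOp T)) ↔ ∀ h, (inner ℂ h (T h)).im = 0 ∧ ‖T h‖ ≤ ‖h‖ := by
  simp only [IsNonneg, cayley, forall_mem_orderIsoMapComap,
    inner_im_of_boundaryForm_apply boundaryForm_cayleyEquiv, inner_cayleyEquiv_re, Prod.forall,
    mem_ofOp, forall_eq, mul_eq_zero, OfNat.ofNat_ne_zero, false_or, sub_nonneg]
  simp only [sq_le_sq₀ (norm_nonneg _) (norm_nonneg _)]

theorem adjoint_ofOp [CompleteSpace M] (T : M →L[ℂ] M) :
    (ofOp T).adjoint = ofOp (ContinuousLinearMap.adjoint T) := by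
  ext q
  simp only [mem_adjoint_iff_boundaryForm, Prod.forall, mem_ofOp, forall_eq, boundaryForm,
    ← ContinuousLinearMap.adjoint_inner_right, sub_eq_zero]
  exact ⟨fun h => (ext_inner_left ℂ h).symm, fun h _ => by rw [h]⟩

end LinRel

theorem ringInverse_apply_eq_iff {M : Type*} [NormedAddCommGroup M] [NormedSpace ℂ M]
    {U : M →L[ℂ] M} (hU : IsUnit U) {x y : M} : Ring.inverse U x = y ↔ x = U y := by
  obtain ⟨U, rfl⟩ := hU
  rw [Ring.inverse_unit]
  exact inv_smul_eq_iff (g := U)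

namespace LinRel

/-! ### Resolvents -/

variable {M : Type*} [NormedAddCommGroup M] [InnerProductSpace ℂ M]
  {A : LinRel M} {μ ν : ℂ} {F G T : M →L[ℂ] M}

theorem isUnit_of_shiftInv_eq_ofOp (hF : shiftInv A μ = ofOp F) (hG : shiftInv A ν = ofOp G) :
    IsUnit (1 + (ν - μ) • F) := by
  have right_inverse {μ ν : ℂ} {F G : M →L[ℂ] M} (hF : shiftInv A μ = ofOp F)
      (hG : shiftInv A ν = ofOp G) : (1 + (ν - μ) • F) * (1 + (μ - ν) • G) = 1 := by
    rw [shiftInv_eq_ofOp_iff] at hF hG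
    ext g
    have hg : F (g - ν • G g + μ • G g) = G g := by
      rw [← hF, hG, sub_add_cancel]
    have arg_eq : (1 + (μ - ν) • G) g = g - ν • G g + μ • G g := by
      simp only [add_apply, smul_apply, one_apply_eq_self]
      module
    rw [mul_apply_eq_comp, arg_eq, add_apply, smul_apply, hg, one_apply_eq_self,
      one_apply_eq_self]
    module
  exact ⟨⟨_, _, right_inverse hF hG, right_inverse hG hF⟩, rfl⟩

theorem shiftInv_eq_ofOp_of_isUnit (hF : shiftInv A μ = ofOp F) (hU : IsUnit (1 + (ν - μ) • F)) :
    shiftInv A ν = ofOp (F * Ring.inverse (1 + (ν - μ) • F)) := by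
  rw [shiftInv_eq_ofOp_iff] at hF ⊢
  intro f f'
  rw [hF, mul_apply_eq_comp]
  constructor <;> intro h
  · have arg_eq : Ring.inverse (1 + (ν - μ) • F) (f' + ν • f) = f' + μ • f := by
      rw [ringInverse_apply_eq_iff hU, add_apply, smul_apply, h, one_apply_eq_self]
      module
    rw [arg_eq, h]
  · generalize hg : Ring.inverse (1 + (ν - μ) • F) (f' + ν • f) = g at h
    rw [ringInverse_apply_eq_iff hU, add_apply, smul_apply, h, one_apply_eq_self] at hg
    have arg_eq : f' + μ • f = g :=
      calc f' + μ • f = f' + ν • f - (ν - μ) • f := by module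
        _ = g := by rw [hg, add_sub_cancel_right]
    rw [arg_eq, h]

theorem shiftInv_one_eq_ofOp_iff :
    shiftInv A 1 = ofOp G ↔ A = cayley (ofOp (1 - (2 : ℂ) • G)) := by
  rw [shiftInv_eq_ofOp_iff, SetLike.ext_iff, Prod.forall]
  refine forall₂_congr fun f f' => ?_
  rw [mem_cayley_ofOp, one_smul, add_comm f' f]
  simp only [sub_apply, smul_apply, one_apply_eq_self]
  rw [← sub_eq_zero (b := f), ← sub_eq_zero (a := f' - f),
    show f' - f - (f + f' - (2 : ℂ) • G (f + f')) = (2 : ℂ) • (G (f + f') - f) by module,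
    smul_eq_zero, or_iff_right two_ne_zero]

theorem shiftInv_cayley_ofOp_one : shiftInv (cayley (ofOp T)) 1 = ofOp ((2 : ℂ)⁻¹ • (1 - T)) := by
  rw [shiftInv_one_eq_ofOp_iff, smul_inv_smul₀ two_ne_zero, sub_sub_cancel]

theorem shiftInv_ofOp (h : IsUnit (T + μ • 1)) :
    shiftInv (ofOp T) μ = ofOp (Ring.inverse (T + μ • 1)) := by
  rw [shiftInv_eq_ofOp_iff]
  intro f f'
  rw [mem_ofOp, ringInverse_apply_eq_iff h, add_apply, smul_apply, one_apply_eq_self,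
    add_left_inj]

end LinRel

/-! ### The Möbius transformation -/

/-- The variable `z = (1 + l) / (1 - l)`, which maps `ℂ \ [0, ∞)` onto
`ℂ \ ((-∞, -1] ∪ [1, ∞))`; the junk value at `l = 1` is `0`. -/
noncomputable def mobius (l : ℂ) : ℂ := (1 + l) / (1 - l)

/-- The inverse `l = (z - 1) / (z + 1)` of `mobius`; the junk value at `z = -1` is `0`. -/
noncomputable def mobiusInv (z : ℂ) : ℂ := (z - 1) / (z + 1)

theorem mem_cutPlane_iff {l : ℂ} : l ∈ cutPlane ↔ l ∈ upperHalf ∨ l ∈ lowerHalf ∨ l ∈ negAxis := by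
  simp only [cutPlane, upperHalf, lowerHalf, negAxis, Set.mem_ofPred_eq]
  rcases lt_trichotomy l.im 0 with h | h | h
  · simp [h, h.ne]
  · simp [h]
  · simp [h, h.ne']

theorem mem_negAxis_iff {l : ℂ} : l ∈ negAxis ↔ l ∈ cutPlane ∧ l.im = 0 := by
  simp only [negAxis, cutPlane, Set.mem_ofPred_eq]
  grind

theorem isOpen_upperHalf : IsOpen upperHalf := isOpen_lt continuous_const Complex.continuous_im

theorem isOpen_lowerHalf : IsOpen lowerHalf := isOpen_lt Complex.continuous_im continuous_const

theorem isOpen_cutPlane : IsOpen cutPlane :=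
  ((isClosed_singleton.preimage Complex.continuous_im).inter
    (isClosed_Ici.preimage Complex.continuous_re)).isOpen_compl

theorem isOpen_doublyCutPlane : IsOpen doublyCutPlane :=
  ((isClosed_singleton.preimage Complex.continuous_im).inter
    ((isClosed_Iic.union isClosed_Ici).preimage Complex.continuous_re)).isOpen_compl

theorem conj_mem_upperHalf_iff {l : ℂ} : conj l ∈ upperHalf ↔ l ∈ lowerHalf := by
  simp [upperHalf, lowerHalf]

theorem I_mem_upperHalf : Complex.I ∈ upperHalf := by simp [upperHalf]

theorem neg_I_mem_lowerHalf : -Complex.I ∈ lowerHalf := by simp [lowerHalf]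

theorem neg_inv_mem_upperHalf {μ : ℂ} (hμ : μ ∈ upperHalf) : -μ⁻¹ ∈ upperHalf := by
  have hμ : 0 < μ.im := hμ
  have normSq_pos : 0 < Complex.normSq μ := Complex.normSq_pos.2 (by rintro rfl; simp at hμ)
  change 0 < (-μ⁻¹).im
  rw [Complex.neg_im, Complex.inv_im, neg_div, neg_neg]
  positivity

theorem neg_inv_mem_lowerHalf {μ : ℂ} (hμ : μ ∈ lowerHalf) : -μ⁻¹ ∈ lowerHalf := by
  rw [← conj_mem_upperHalf_iff] at hμ ⊢
  simpa using neg_inv_mem_upperHalf hμ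

theorem mobius_im (l : ℂ) : (mobius l).im = 2 * l.im / Complex.normSq (1 - l) := by
  rw [mobius, Complex.div_im]
  simp only [Complex.add_im, Complex.one_im, Complex.sub_re, Complex.one_re, Complex.add_re,
    Complex.sub_im]
  ring

theorem mobius_mem_upperHalf_iff {l : ℂ} : mobius l ∈ upperHalf ↔ l ∈ upperHalf := by
  simp only [upperHalf, Set.mem_ofPred_eq, mobius_im]
  rcases eq_or_ne l 1 with rfl | hl
  · simp
  · rw [div_pos_iff_of_pos_right (Complex.normSq_pos.2 (sub_ne_zero.2 hl.symm)),
      mul_pos_iff_of_pos_left two_pos]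

theorem mobius_conj (l : ℂ) : mobius (conj l) = conj (mobius l) := by
  simp [mobius]

theorem mobius_mem_lowerHalf_iff {l : ℂ} : mobius l ∈ lowerHalf ↔ l ∈ lowerHalf := by
  rw [← conj_mem_upperHalf_iff, ← mobius_conj, mobius_mem_upperHalf_iff, conj_mem_upperHalf_iff]

theorem mobius_mobiusInv {z : ℂ} (hz : z ≠ -1) : mobius (mobiusInv z) = z := by
  have h : z + 1 ≠ 0 := fun h => hz (eq_neg_of_add_eq_zero_left h)
  rw [mobius, mobiusInv, one_add_div h, one_sub_div h, div_div_div_cancel_right₀ h]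
  ring

theorem mobiusInv_mobius {l : ℂ} (hl : l ≠ 1) : mobiusInv (mobius l) = l := by
  have h : 1 - l ≠ 0 := sub_ne_zero.2 hl.symm
  rw [mobiusInv, mobius, div_sub_one h, div_add_one h, div_div_div_cancel_right₀ h]
  ring

theorem ne_one_of_mem_cutPlane {l : ℂ} (hl : l ∈ cutPlane) : l ≠ 1 := by
  rintro rfl
  exact hl (by simp)

theorem ne_neg_one_of_mem_doublyCutPlane {z : ℂ} (hz : z ∈ doublyCutPlane) : z ≠ -1 := by
  rintro rfl
  exact hz (by simp)

theorem mobiusInv_im (z : ℂ) : (mobiusInv z).im = 2 * z.im / Complex.normSq (z + 1) := by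
  rw [mobiusInv, Complex.div_im]
  simp only [Complex.add_im, Complex.one_im, Complex.sub_re, Complex.one_re, Complex.add_re,
    Complex.sub_im]
  ring

theorem mobiusInv_re (z : ℂ) :
    (mobiusInv z).re = (Complex.normSq z - 1) / Complex.normSq (z + 1) := by
  rw [mobiusInv, Complex.div_re, Complex.normSq_apply z]
  simp only [Complex.add_im, Complex.one_im, Complex.sub_re, Complex.one_re, Complex.add_re,
    Complex.sub_im]
  ring

theorem mobiusInv_mem_cutPlane_iff {z : ℂ} : mobiusInv z ∈ cutPlane ↔ z ∈ doublyCutPlane := by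
  rcases eq_or_ne z (-1) with rfl | hz
  · simp [cutPlane, doublyCutPlane, mobiusInv]
  have hpos : 0 < Complex.normSq (z + 1) :=
    Complex.normSq_pos.2 fun h => hz (eq_neg_of_add_eq_zero_left h)
  simp only [cutPlane, doublyCutPlane, Set.mem_ofPred_eq, mobiusInv_im, mobiusInv_re,
    div_eq_zero_iff, hpos.ne', or_false, mul_eq_zero, two_ne_zero, false_or,
    le_div_iff₀ hpos, zero_mul, sub_nonneg]
  refine not_congr (and_congr_right fun him => ?_)
  rw [Complex.normSq_apply, him, mul_zero, add_zero, ← sq, one_le_sq_iff_one_le_abs, le_abs']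

theorem mobius_mem_doublyCutPlane {l : ℂ} (hl : l ∈ cutPlane) : mobius l ∈ doublyCutPlane := by
  rwa [← mobiusInv_mem_cutPlane_iff, mobiusInv_mobius (ne_one_of_mem_cutPlane hl)]

theorem exists_mobius_eq {z : ℂ} (hz : z ∈ doublyCutPlane) : ∃ l, mobius l = z :=
  ⟨mobiusInv z, mobius_mobiusInv (ne_neg_one_of_mem_doublyCutPlane hz)⟩

theorem mobiusInv_mem_negAxis {x : ℝ} (h₁ : -1 < x) (h₂ : x < 1) : mobiusInv x ∈ negAxis := by
  rw [mem_negAxis_iff, mobiusInv_mem_cutPlane_iff, mobiusInv_im]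
  simp [doublyCutPlane, h₁, h₂]

theorem exists_ofReal_eq_mobius {l : ℂ} (hl : l ∈ negAxis) :
    ∃ x : ℝ, -1 < x ∧ x < 1 ∧ mobius l = x := by
  obtain ⟨hcut, him⟩ := mem_negAxis_iff.1 hl
  have h := mobius_mem_doublyCutPlane hcut
  have hreal : (mobius l).im = 0 := by rw [mobius_im, him, mul_zero, zero_div]
  simp only [doublyCutPlane, Set.mem_ofPred_eq, hreal, true_and, not_or, not_le] at h
  exact ⟨_, h.1, h.2, Complex.ext rfl hreal⟩

/-! ### Invertibility and order bounds for operators -/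

theorem analyticAt_ringInverse {𝕜 R A : Type*} [NontriviallyNormedField 𝕜]
    [NormedAddCommGroup R] [NormedSpace 𝕜 R] [NormedRing A] [NormedAlgebra 𝕜 A] [CompleteSpace A]
    {f : R → A} {x : R} (hf : AnalyticAt 𝕜 f x) (hu : IsUnit (f x)) :
    AnalyticAt 𝕜 (fun w => Ring.inverse (f w)) x := by
  obtain ⟨u, hu⟩ := hu
  have hinv : AnalyticAt 𝕜 Ring.inverse (f x) := hu ▸ analyticAt_inverse u
  exact hinv.fun_comp hf

section Operators

variable {M : Type*} [NormedAddCommGroup M] [InnerProductSpace ℂ M] [CompleteSpace M]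
  {T : M →L[ℂ] M} {μ : ℂ}

theorem isUnit_add_smul_one (hμ : μ.im ≠ 0) (hT : ∀ x, 0 ≤ μ.im * (inner ℂ x (T x)).im) :
    IsUnit (T + μ • 1) := by
  refine ContinuousLinearMap.isUnit_of_forall_le_norm_inner_map _ (c := ‖μ.im‖₊)
    (nnnorm_pos.2 hμ) fun x => ?_
  have him : (inner ℂ x ((T + μ • (1 : M →L[ℂ] M)) x)).im =
      (inner ℂ x (T x)).im + μ.im * ‖x‖ ^ 2 := by
    rw [add_apply, smul_apply, one_apply_eq_self, inner_add_right, inner_smul_right,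
      inner_self_eq_norm_sq_to_K, Complex.add_im, ← RCLike.ofReal_pow]
    exact congrArg _ (Complex.im_mul_ofReal _ _)
  have key : |μ.im| * (‖x‖ ^ 2 * |μ.im|) ≤
      |μ.im| * |(inner ℂ x ((T + μ • (1 : M →L[ℂ] M)) x)).im| := by
    rw [← abs_mul, him]
    refine le_trans ?_ (le_abs_self _)
    rw [mul_left_comm, abs_mul_abs_self]
    linarith [hT x]
  rw [norm_inner_symm]
  exact (le_of_mul_le_mul_left key (abs_pos.2 hμ)).trans (Complex.abs_im_le_norm _)

theorem isSelfAdjoint_of_inner_im_eq_zero (h : ∀ x, (inner ℂ x (T x)).im = 0) :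
    IsSelfAdjoint T := by
  rw [ContinuousLinearMap.isSelfAdjoint_iff_isSymmetric,
    LinearMap.isSymmetric_iff_inner_map_self_real]
  intro x
  rw [ContinuousLinearMap.coe_coe, Complex.conj_eq_iff_im, ← inner_conj_symm, Complex.conj_im, h,
    neg_zero]

theorem isNonneg_cayley_ofOp_of_neg_one_le_of_le_one (h₁ : -1 ≤ T) (h₂ : T ≤ 1) :
    IsNonneg (cayley (ofOp T)) := by
  intro p hp
  obtain ⟨h, rfl⟩ := mem_cayley_ofOp_iff_exists.1 hp
  have hadd : 0 ≤ 1 + T := neg_le_iff_add_nonneg'.1 h₁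
  have hsub : 0 ≤ 1 - T := sub_nonneg.2 h₂
  have hcomm : Commute (1 - T) (1 + T) :=
    ((Commute.one_left _).sub_left ((Commute.one_right T).add_right (Commute.refl T)))
  have hprod : 0 ≤ inner ℂ h ((1 - T) ((1 + T) h)) :=
    ((ContinuousLinearMap.nonneg_iff_isPositive _).1
      (hcomm.mul_nonneg hsub hadd)).inner_nonneg_right h
  have hsymm : inner ℂ ((1 - T) h) ((1 + T) h) = inner ℂ h ((1 - T) ((1 + T) h)) :=
    ((ContinuousLinearMap.nonneg_iff_isPositive _).1 hsub).isSymmetric h _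
  rw [← hsymm, Complex.nonneg_iff] at hprod
  exact ⟨hprod.2.symm, hprod.1⟩

theorem neg_one_le_and_le_one_iff_isNonneg_cayley :
    (-1 ≤ T ∧ T ≤ 1) ↔ IsNonneg (cayley (ofOp T)) := by
  refine ⟨fun h => isNonneg_cayley_ofOp_of_neg_one_le_of_le_one h.1 h.2, fun H => ?_⟩
  rw [isNonneg_cayley_ofOp] at H
  have hself : IsSelfAdjoint T := isSelfAdjoint_of_inner_im_eq_zero fun x => (H x).1
  have hnorm : ‖T‖ ≤ 1 := T.opNorm_le_bound zero_le_one fun x => by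
    rw [one_mul]
    exact (H x).2
  have hle : algebraMap ℝ (M →L[ℂ] M) ‖T‖ ≤ 1 :=
    (algebraMap_mono _ hnorm).trans_eq (map_one _)
  exact ⟨(neg_le_neg hle).trans hself.neg_algebraMap_norm_le_self,
    hself.le_algebraMap_norm_self.trans hle⟩

end Operators

/-! ### The transforms as Cayley transforms -/

section Transforms

variable {M : Type*} [NormedAddCommGroup M] [InnerProductSpace ℂ M] (Ω : ℂ → M →L[ℂ] M) (l : ℂ)

theorem stieltjesTransform_eq_cayley :
    stieltjesTransform Ω l = cayley (ofOp (Ω (mobius l))) := by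
  ext ⟨f, f'⟩
  rw [stieltjesTransform, LinRel.add_comm, mem_add_ofOp, mem_smul two_ne_zero, LinRel.mem_inv,
    mem_ofOp, mem_cayley_ofOp, ← mobius]
  simp only [neg_apply, sub_apply, one_apply_eq_self, sub_neg_eq_add, add_comm f' f, map_smul]
  rw [← sub_eq_zero (a := f), ← sub_eq_zero (a := f' - f),
    show f - (2 : ℂ)⁻¹ • (f + f' - Ω (mobius l) (f + f')) =
      -(2 : ℂ)⁻¹ • (f' - f - Ω (mobius l) (f + f')) by module,
    smul_eq_zero, or_iff_right (by norm_num)]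

theorem inverseStieltjesTransform_eq_negInv :
    inverseStieltjesTransform Ω l = negInv (stieltjesTransform Ω l) := by
  ext ⟨f, f'⟩
  rw [stieltjesTransform_eq_cayley, mem_negInv, mem_cayley_ofOp, inverseStieltjesTransform, neg,
    LinRel.add_comm, mem_add_ofOp, mem_smul (neg_ne_zero.2 one_ne_zero), mem_smul two_ne_zero,
    LinRel.mem_inv, mem_ofOp, ← mobius]
  simp only [add_apply, one_apply_eq_self, map_smul, map_add, map_sub, map_neg]
  rw [← sub_eq_zero (a := f), ← sub_eq_zero (a := -f - f')]
  generalize Ω (mobius l) f = a, Ω (mobius l) f' = b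
  rw [show f - (2 : ℂ)⁻¹ • (-1 : ℂ)⁻¹ • (f' + b - (f + a)) =
      -(2 : ℂ)⁻¹ • (-f - f' - (b + -a)) by module,
    smul_eq_zero, or_iff_right (by norm_num)]

theorem coe_stieltjesTransform : (stieltjesTransform Ω l : Set (M × M)) =
    {p | ∃ h : M, p = ((1 - Ω (mobius l)) h, (1 + Ω (mobius l)) h)} := by
  ext p
  rw [SetLike.mem_coe, stieltjesTransform_eq_cayley, mem_cayley_ofOp_iff_exists]
  rfl

theorem coe_inverseStieltjesTransform : (inverseStieltjesTransform Ω l : Set (M × M)) =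
    {p | ∃ h : M, p = ((1 + Ω (mobius l)) h, (Ω (mobius l) - 1) h)} := by
  ext ⟨f, f'⟩
  rw [SetLike.mem_coe, inverseStieltjesTransform_eq_negInv, stieltjesTransform_eq_cayley,
    mem_negInv, mem_cayley_ofOp_iff_exists, Set.mem_ofPred_eq]
  refine (Equiv.neg M).exists_congr fun h => ?_
  simp only [Equiv.neg_apply, Prod.mk_inj, map_neg, sub_apply, neg_eq_iff_eq_neg, one_apply_eq_self,
    neg_sub]
  exact and_comm

end Transforms

/-! ### Stieltjes and inverse Stieltjes families -/

section NegInv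

variable {M : Type*} [NormedAddCommGroup M] [InnerProductSpace ℂ M] {𝓜 : ℂ → LinRel M}

theorem ResolventAnalyticOn.negInv {μ : ℂ} {S : Set ℂ} (hμ : μ ≠ 0)
    (h : ResolventAnalyticOn 𝓜 μ S) :
    ResolventAnalyticOn (fun l => LinRel.negInv (𝓜 l)) (-μ⁻¹) S := by
  obtain ⟨F, hF, hF_eq⟩ := h
  refine ⟨_, fun l hl => ?_, fun l hl => shiftInv_negInv hμ (hF_eq l hl)⟩
  exact analyticAt_const.fun_smul (analyticAt_const.sub (analyticAt_const.fun_smul (hF l hl)))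

theorem exists_resolventAnalyticOn_negInv_upper {S : Set ℂ}
    (h : ∃ μ ∈ upperHalf, ResolventAnalyticOn 𝓜 μ S) :
    ∃ μ ∈ upperHalf, ResolventAnalyticOn (fun l => LinRel.negInv (𝓜 l)) μ S := by
  obtain ⟨μ, hμ, h⟩ := h
  refine ⟨_, neg_inv_mem_upperHalf hμ, h.negInv ?_⟩
  rintro rfl
  simp [upperHalf] at hμ

theorem exists_resolventAnalyticOn_negInv_lower {S : Set ℂ}
    (h : ∃ μ ∈ lowerHalf, ResolventAnalyticOn 𝓜 μ S) :
    ∃ μ ∈ lowerHalf, ResolventAnalyticOn (fun l => LinRel.negInv (𝓜 l)) μ S := by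
  obtain ⟨μ, hμ, h⟩ := h
  refine ⟨_, neg_inv_mem_lowerHalf hμ, h.negInv ?_⟩
  rintro rfl
  simp [lowerHalf] at hμ

variable [CompleteSpace M]

theorem IsNevanlinnaFamily.negInv (h : IsNevanlinnaFamily 𝓜) :
    IsNevanlinnaFamily fun l => LinRel.negInv (𝓜 l) where
  dissipative l hl :=
    (maximal_orderIso_apply_iff LinRel.negInv isDissipative_negInv _).2 (h.dissipative l hl)
  accumulative l hl :=
    (maximal_orderIso_apply_iff LinRel.negInv isAccumulative_negInv _).2 (h.accumulative l hl)
  adjoint_eq l hl := by rw [adjoint_negInv, h.adjoint_eq l hl]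
  holomorphic_upper := exists_resolventAnalyticOn_negInv_upper h.holomorphic_upper
  holomorphic_lower := exists_resolventAnalyticOn_negInv_lower h.holomorphic_lower

theorem IsStieltjesFamily.negInv (h : IsStieltjesFamily 𝓜) :
    IsInverseStieltjesFamily fun l => LinRel.negInv (𝓜 l) where
  nevanlinna := h.nevanlinna.negInv
  nonpos x hx := (isNonpos_negInv _).2 (h.nonneg x hx)
  continuation_upper := exists_resolventAnalyticOn_negInv_upper h.continuation_upper
  continuation_lower := exists_resolventAnalyticOn_negInv_lower h.continuation_lower

theorem IsInverseStieltjesFamily.negInv (h : IsInverseStieltjesFamily 𝓜) :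
    IsStieltjesFamily fun l => LinRel.negInv (𝓜 l) where
  nevanlinna := h.nevanlinna.negInv
  nonneg x hx := (isNonneg_negInv _).2 (h.nonpos x hx)
  continuation_upper := exists_resolventAnalyticOn_negInv_upper h.continuation_upper
  continuation_lower := exists_resolventAnalyticOn_negInv_lower h.continuation_lower

theorem isStieltjesFamily_iff_isInverseStieltjesFamily_negInv :
    IsStieltjesFamily 𝓜 ↔ IsInverseStieltjesFamily fun l => LinRel.negInv (𝓜 l) := by
  refine ⟨IsStieltjesFamily.negInv, fun h => ?_⟩
  simpa only [negInv_negInv] using h.negInv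

end NegInv

/-! ### Schur functions on the cut plane -/

theorem ResolventAnalyticOn.mono {M : Type*} [NormedAddCommGroup M] [InnerProductSpace ℂ M]
    {𝓜 : ℂ → LinRel M} {μ : ℂ} {S S' : Set ℂ} (h : ResolventAnalyticOn 𝓜 μ S) (hS : S' ⊆ S) :
    ResolventAnalyticOn 𝓜 μ S' := by
  obtain ⟨F, hF, hF_eq⟩ := h
  exact ⟨F, hF.mono hS, fun l hl => hF_eq l (hS hl)⟩

section ResolventAnalyticOn

variable {M : Type*} [NormedAddCommGroup M] [InnerProductSpace ℂ M] [CompleteSpace M]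
  {ω : ℂ → M →L[ℂ] M} {μ : ℂ} {S : Set ℂ}

theorem resolventAnalyticOn_ofOp (hω : AnalyticOnNhd ℂ ω S)
    (hU : ∀ l ∈ S, IsUnit (ω l + μ • 1)) : ResolventAnalyticOn (fun l => ofOp (ω l)) μ S :=
  ⟨_, fun l hl => analyticAt_ringInverse ((hω l hl).fun_add analyticAt_const) (hU l hl),
    fun l hl => shiftInv_ofOp (hU l hl)⟩

theorem resolventAnalyticOn_cayley_ofOp (hμ : μ ≠ 1) (hω : AnalyticOnNhd ℂ ω S)
    (hU : ∀ l ∈ S, IsUnit (ω l + mobius μ • 1)) :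
    ResolventAnalyticOn (fun l => cayley (ofOp (ω l))) μ S := by
  have hμ : 1 - μ ≠ 0 := sub_ne_zero.2 hμ.symm
  have hV : ∀ l ∈ S, IsUnit (1 + (μ - 1) • (2 : ℂ)⁻¹ • (1 - ω l)) := fun l hl => by
    have eq : 1 + (μ - 1) • (2 : ℂ)⁻¹ • (1 - ω l) =
        ((1 - μ) / 2) • (ω l + mobius μ • 1) := by
      rw [smul_add ((1 - μ) / 2), smul_smul ((1 - μ) / 2), mobius,
        show (1 - μ) / 2 * ((1 + μ) / (1 - μ)) = (1 + μ) / 2 by field_simp]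
      module
    rw [eq]
    exact (hU l hl).smul (Units.mk0 _ (div_ne_zero hμ two_ne_zero))
  have hF : AnalyticOnNhd ℂ (fun l => (2 : ℂ)⁻¹ • (1 - ω l)) S := fun l hl =>
    analyticAt_const.fun_smul (analyticAt_const.sub (hω l hl))
  exact ⟨_, fun l hl => (hF l hl).mul (analyticAt_ringInverse
      (analyticAt_const.fun_add (analyticAt_const.fun_smul (hF l hl))) (hV l hl)),
    fun l hl => shiftInv_eq_ofOp_of_isUnit shiftInv_cayley_ofOp_one (hV l hl)⟩

theorem ResolventAnalyticOn.exists_analyticOnNhd {𝓜 : ℂ → LinRel M}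
    (h : ResolventAnalyticOn 𝓜 μ S) (hω : ∀ l ∈ S, 𝓜 l = cayley (ofOp (ω l))) :
    ∃ Φ : ℂ → M →L[ℂ] M, AnalyticOnNhd ℂ Φ S ∧ Set.EqOn ω Φ S := by
  obtain ⟨F, hF, hF_eq⟩ := h
  have hU : ∀ l ∈ S, IsUnit (1 + (1 - μ) • F l) := fun l hl =>
    isUnit_of_shiftInv_eq_ofOp (hF_eq l hl) (hω l hl ▸ shiftInv_cayley_ofOp_one)
  refine ⟨fun l => 1 - (2 : ℂ) • (F l * Ring.inverse (1 + (1 - μ) • F l)), fun l hl => ?_,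
    fun l hl => ?_⟩
  · exact analyticAt_const.sub (analyticAt_const.fun_smul ((hF l hl).mul (analyticAt_ringInverse
      (analyticAt_const.fun_add (analyticAt_const.fun_smul (hF l hl))) (hU l hl))))
  · have h_one := shiftInv_eq_ofOp_of_isUnit (hF_eq l hl) (hU l hl)
    rw [shiftInv_one_eq_ofOp_iff, hω l hl] at h_one
    exact ofOp_injective (cayley.injective h_one)

end ResolventAnalyticOn

theorem frequently_mem_negAxis {l : ℂ} (hl : l ∈ negAxis) : ∃ᶠ w in 𝓝[≠] l, w ∈ negAxis := by
  have hsub : Tendsto (fun t : ℝ => l - t) (𝓝[>] 0) (𝓝[≠] l) := by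
    refine tendsto_nhdsWithin_of_tendsto_nhds_of_eventually_within _ ?_
      (eventually_mem_nhdsWithin.mono fun t ht => by simpa using ht.ne')
    have hcont : Continuous fun t : ℝ => l - t := by fun_prop
    simpa using (hcont.tendsto 0).mono_left nhdsWithin_le_nhds
  refine hsub.frequently (eventually_mem_nhdsWithin.mono fun t ht => ⟨?_, ?_⟩).frequently
  · simpa using hl.1
  · have ht : 0 < t := ht
    have hre : l.re < 0 := hl.2
    rw [Complex.sub_re, Complex.ofReal_re]
    linarith

theorem analyticOnNhd_cutPlane {E : Type*} [NormedAddCommGroup E] [NormedSpace ℂ E]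
    {ω Φ Ψ : ℂ → E} (hΦ : AnalyticOnNhd ℂ Φ (upperHalf ∪ negAxis))
    (hωΦ : Set.EqOn ω Φ (upperHalf ∪ negAxis)) (hΨ : AnalyticOnNhd ℂ Ψ (lowerHalf ∪ negAxis))
    (hωΨ : Set.EqOn ω Ψ (lowerHalf ∪ negAxis)) : AnalyticOnNhd ℂ ω cutPlane := by
  intro l hl
  rcases mem_cutPlane_iff.1 hl with h | h | h
  · refine (hΦ l (Or.inl h)).congr ?_
    filter_upwards [isOpen_upperHalf.mem_nhds h] with w hw using (hωΦ (Or.inl hw)).symm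
  · refine (hΨ l (Or.inl h)).congr ?_
    filter_upwards [isOpen_lowerHalf.mem_nhds h] with w hw using (hωΨ (Or.inl hw)).symm
  · have hΦΨ : ∀ᶠ w in 𝓝 l, Φ w = Ψ w := by
      refine ((hΦ l (Or.inr h)).frequently_eq_iff_eventually_eq (hΨ l (Or.inr h))).1 ?_
      exact (frequently_mem_negAxis h).mono fun w hw =>
        (hωΦ (Or.inr hw)).symm.trans (hωΨ (Or.inr hw))
    refine (hΦ l (Or.inr h)).congr ?_
    filter_upwards [isOpen_cutPlane.mem_nhds hl, hΦΨ] with w hw hΦΨ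
    rcases mem_cutPlane_iff.1 hw with hw | hw | hw
    · exact (hωΦ (Or.inl hw)).symm
    · exact hΦΨ.trans (hωΨ (Or.inl hw)).symm
    · exact (hωΦ (Or.inr hw)).symm

section IsCutPlaneSchur

variable {M : Type*} [NormedAddCommGroup M] [InnerProductSpace ℂ M] [CompleteSpace M]
  {Ω ω : ℂ → M →L[ℂ] M} {Q : ℂ → LinRel M}

/-- The pull-back of the class `IsNevanlinnaSchur` along `mobius`, in terms of the variable
`l ∈ ℂ \ [0, ∞)`. The two resolvent conditions are absorbed in the analyticity of `ω`, since they
follow from it for operators with a semidefinite imaginary part. -/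
structure IsCutPlaneSchur (ω : ℂ → M →L[ℂ] M) : Prop where
  dissipative : ∀ l ∈ upperHalf, Maximal IsDissipative (ofOp (ω l))
  accumulative : ∀ l ∈ lowerHalf, Maximal IsAccumulative (ofOp (ω l))
  adjoint_eq : ∀ l : ℂ, l.im ≠ 0 → (ofOp (ω l)).adjoint = ofOp (ω (conj l))
  analytic : AnalyticOnNhd ℂ ω cutPlane
  bounds : ∀ x ∈ negAxis, -1 ≤ ω x ∧ ω x ≤ 1

namespace IsCutPlaneSchur

theorem isUnit_add_smul_one_of_mem_upperHalf (h : IsCutPlaneSchur ω) {l μ : ℂ}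
    (hl : l ∈ upperHalf ∪ negAxis) (hμ : μ ∈ upperHalf) : IsUnit (ω l + μ • 1) := by
  have hμ : 0 < μ.im := hμ
  refine isUnit_add_smul_one hμ.ne' fun x => mul_nonneg hμ.le ?_
  rcases hl with hl | hl
  · exact (h.dissipative l hl).prop (x, ω l x) (mem_ofOp.2 rfl)
  · exact ((isNonneg_cayley_ofOp _).1
      (neg_one_le_and_le_one_iff_isNonneg_cayley.1 (h.bounds l hl)) x).1.ge

theorem isUnit_add_smul_one_of_mem_lowerHalf (h : IsCutPlaneSchur ω) {l μ : ℂ}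
    (hl : l ∈ lowerHalf ∪ negAxis) (hμ : μ ∈ lowerHalf) : IsUnit (ω l + μ • 1) := by
  have hμ : μ.im < 0 := hμ
  refine isUnit_add_smul_one hμ.ne fun x => mul_nonneg_of_nonpos_of_nonpos hμ.le ?_
  rcases hl with hl | hl
  · exact (h.accumulative l hl).prop (x, ω l x) (mem_ofOp.2 rfl)
  · exact ((isNonneg_cayley_ofOp _).1
      (neg_one_le_and_le_one_iff_isNonneg_cayley.1 (h.bounds l hl)) x).1.le

theorem isStieltjesFamily (h : IsCutPlaneSchur ω) :
    IsStieltjesFamily fun l => cayley (ofOp (ω l)) := by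
  have upper : ResolventAnalyticOn (fun l => cayley (ofOp (ω l))) Complex.I
      (upperHalf ∪ negAxis) := by
    refine resolventAnalyticOn_cayley_ofOp (by simp [Complex.ext_iff]) (h.analytic.mono ?_)
      fun l hl => h.isUnit_add_smul_one_of_mem_upperHalf hl
        (mobius_mem_upperHalf_iff.2 I_mem_upperHalf)
    exact fun l hl => mem_cutPlane_iff.2 (hl.imp_right Or.inr)
  have lower : ResolventAnalyticOn (fun l => cayley (ofOp (ω l))) (-Complex.I)
      (lowerHalf ∪ negAxis) := by
    refine resolventAnalyticOn_cayley_ofOp (by simp [Complex.ext_iff]) (h.analytic.mono ?_)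
      fun l hl => h.isUnit_add_smul_one_of_mem_lowerHalf hl
        (mobius_mem_lowerHalf_iff.2 neg_I_mem_lowerHalf)
    exact fun l hl => mem_cutPlane_iff.2 (Or.inr hl)
  exact
    { nevanlinna :=
        { dissipative := fun l hl =>
            (maximal_orderIso_apply_iff cayley isDissipative_cayley _).2 (h.dissipative l hl)
          accumulative := fun l hl =>
            (maximal_orderIso_apply_iff cayley isAccumulative_cayley _).2 (h.accumulative l hl)
          adjoint_eq := fun l hl => by rw [adjoint_cayley, h.adjoint_eq l hl]
          holomorphic_upper := ⟨_, I_mem_upperHalf, upper.mono Set.subset_union_left⟩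
          holomorphic_lower := ⟨_, neg_I_mem_lowerHalf, lower.mono Set.subset_union_left⟩ }
      nonneg := fun x hx => neg_one_le_and_le_one_iff_isNonneg_cayley.1 (h.bounds x hx)
      continuation_upper := ⟨_, I_mem_upperHalf, upper⟩
      continuation_lower := ⟨_, neg_I_mem_lowerHalf, lower⟩ }

end IsCutPlaneSchur

theorem IsStieltjesFamily.isCutPlaneSchur (h : IsStieltjesFamily Q)
    (hω : ∀ l ∈ cutPlane, Q l = cayley (ofOp (ω l))) : IsCutPlaneSchur ω where
  dissipative l hl := by
    rw [← maximal_orderIso_apply_iff cayley isDissipative_cayley,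
      ← hω l (mem_cutPlane_iff.2 (Or.inl hl))]
    exact h.nevanlinna.dissipative l hl
  accumulative l hl := by
    rw [← maximal_orderIso_apply_iff cayley isAccumulative_cayley,
      ← hω l (mem_cutPlane_iff.2 (Or.inr (Or.inl hl)))]
    exact h.nevanlinna.accumulative l hl
  adjoint_eq l hl := by
    have hl_conj : (conj l).im ≠ 0 := by simpa using hl
    refine cayley.injective ?_
    rw [← adjoint_cayley, ← hω l fun hl' => hl hl'.1, ← hω _ fun hl' => hl_conj hl'.1]
    exact h.nevanlinna.adjoint_eq l hl
  analytic := by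
    obtain ⟨μ, -, hμ⟩ := h.continuation_upper
    obtain ⟨ν, -, hν⟩ := h.continuation_lower
    obtain ⟨Φ, hΦ, hωΦ⟩ := hμ.exists_analyticOnNhd fun l hl =>
      hω l (mem_cutPlane_iff.2 (hl.imp_right Or.inr))
    obtain ⟨Ψ, hΨ, hωΨ⟩ := hν.exists_analyticOnNhd fun l hl =>
      hω l (mem_cutPlane_iff.2 (Or.inr hl))
    exact analyticOnNhd_cutPlane hΦ hωΦ hΨ hωΨ
  bounds x hx := by
    rw [neg_one_le_and_le_one_iff_isNonneg_cayley, ← hω x (mem_negAxis_iff.1 hx).1]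
    exact h.nonneg x hx

theorem isCutPlaneSchur_iff_isStieltjesFamily :
    IsCutPlaneSchur ω ↔ IsStieltjesFamily fun l => cayley (ofOp (ω l)) :=
  ⟨IsCutPlaneSchur.isStieltjesFamily, fun h => h.isCutPlaneSchur fun _ _ => rfl⟩

theorem IsNevanlinnaSchur.isCutPlaneSchur (h : IsNevanlinnaSchur Ω) :
    IsCutPlaneSchur fun l => Ω (mobius l) where
  dissipative l hl := h.nevanlinna.dissipative _ (mobius_mem_upperHalf_iff.2 hl)
  accumulative l hl := h.nevanlinna.accumulative _ (mobius_mem_lowerHalf_iff.2 hl)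
  adjoint_eq l hl := by
    rw [mobius_conj]
    refine h.nevanlinna.adjoint_eq _ ?_
    rcases hl.lt_or_gt with hl | hl
    exacts [(mobius_mem_lowerHalf_iff.2 hl).ne, (mobius_mem_upperHalf_iff.2 hl).ne']
  analytic l hl := by
    have hmobius : AnalyticAt ℂ mobius l :=
      (analyticAt_const.add analyticAt_id).div (analyticAt_const.sub analyticAt_id)
        (sub_ne_zero.2 (ne_one_of_mem_cutPlane hl).symm)
    exact (h.holomorphic.analyticOnNhd isOpen_doublyCutPlane _
      (mobius_mem_doublyCutPlane hl)).fun_comp hmobius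
  bounds l hl := by
    obtain ⟨x, hx₁, hx₂, hx⟩ := exists_ofReal_eq_mobius hl
    rw [hx]
    exact h.bounds x hx₁ hx₂

theorem IsCutPlaneSchur.isNevanlinnaSchur (h : IsCutPlaneSchur fun l => Ω (mobius l)) :
    IsNevanlinnaSchur Ω := by
  have analytic : AnalyticOnNhd ℂ Ω doublyCutPlane := fun z hz => by
    have hmobiusInv : AnalyticAt ℂ mobiusInv z :=
      (analyticAt_id.sub analyticAt_const).div (analyticAt_id.add analyticAt_const)
        fun h => ne_neg_one_of_mem_doublyCutPlane hz (eq_neg_of_add_eq_zero_left h)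
    refine ((h.analytic _ (mobiusInv_mem_cutPlane_iff.2 hz)).fun_comp hmobiusInv).congr ?_
    filter_upwards [isOpen_doublyCutPlane.mem_nhds hz] with w hw
    rw [mobius_mobiusInv (ne_neg_one_of_mem_doublyCutPlane hw)]
  have upper_subset : upperHalf ⊆ doublyCutPlane := fun z hz h => hz.ne' h.1
  have lower_subset : lowerHalf ⊆ doublyCutPlane := fun z hz h => hz.ne h.1
  refine ⟨⟨fun z hz => ?_, fun z hz => ?_, fun z hz => ?_,
    ⟨_, I_mem_upperHalf, resolventAnalyticOn_ofOp (analytic.mono upper_subset) fun z hz => ?_⟩,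
    ⟨_, neg_I_mem_lowerHalf, resolventAnalyticOn_ofOp (analytic.mono lower_subset) fun z hz => ?_⟩⟩,
    analytic.differentiableOn, fun x hx₁ hx₂ => ?_⟩
  · obtain ⟨l, rfl⟩ := exists_mobius_eq (upper_subset hz)
    exact h.dissipative l (mobius_mem_upperHalf_iff.1 hz)
  · obtain ⟨l, rfl⟩ := exists_mobius_eq (lower_subset hz)
    exact h.accumulative l (mobius_mem_lowerHalf_iff.1 hz)
  · obtain ⟨l, rfl⟩ := exists_mobius_eq fun h => hz h.1
    rw [← mobius_conj]
    exact h.adjoint_eq l fun hl => hz (by rw [mobius_im, hl, mul_zero, zero_div])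
  · obtain ⟨l, rfl⟩ := exists_mobius_eq (upper_subset hz)
    exact h.isUnit_add_smul_one_of_mem_upperHalf (Or.inl (mobius_mem_upperHalf_iff.1 hz))
      I_mem_upperHalf
  · obtain ⟨l, rfl⟩ := exists_mobius_eq (lower_subset hz)
    exact h.isUnit_add_smul_one_of_mem_lowerHalf (Or.inl (mobius_mem_lowerHalf_iff.1 hz))
      neg_I_mem_lowerHalf
  · have hx : mobiusInv x ∈ negAxis := mobiusInv_mem_negAxis hx₁ hx₂
    have hx' : (x : ℂ) ∈ doublyCutPlane := mobiusInv_mem_cutPlane_iff.1 (mem_negAxis_iff.1 hx).1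
    have hb := h.bounds _ hx
    rwa [mobius_mobiusInv (ne_neg_one_of_mem_doublyCutPlane hx')] at hb

theorem isNevanlinnaSchur_iff_isStieltjesFamily :
    IsNevanlinnaSchur Ω ↔ IsStieltjesFamily (stieltjesTransform Ω) := by
  rw [funext (stieltjesTransform_eq_cayley Ω), ← isCutPlaneSchur_iff_isStieltjesFamily]
  exact ⟨IsNevanlinnaSchur.isCutPlaneSchur, IsCutPlaneSchur.isNevanlinnaSchur⟩

theorem isNevanlinnaSchur_iff_isInverseStieltjesFamily :
    IsNevanlinnaSchur Ω ↔ IsInverseStieltjesFamily (inverseStieltjesTransform Ω) := by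
  rw [isNevanlinnaSchur_iff_isStieltjesFamily,
    isStieltjesFamily_iff_isInverseStieltjesFamily_negInv,
    funext (inverseStieltjesTransform_eq_negInv Ω)]

end IsCutPlaneSchur

/-! ### Existence of the Cayley transform -/

theorem mul_norm_le_mul_norm_center_of_re_nonneg {f : ℂ → ℂ} {c z : ℂ} {R : ℝ}
    (hf : DifferentiableOn ℂ f (Metric.ball c R)) (hre : ∀ w ∈ Metric.ball c R, 0 ≤ (f w).re)
    (hz : z ∈ Metric.ball c R) : (R - dist z c) * ‖f z‖ ≤ (R + dist z c) * ‖f c‖ := by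
  have hzR : dist z c < R := hz
  have hadd : Set.MapsTo (fun w => c + w) (Metric.ball 0 R) (Metric.ball c R) := fun w hw => by
    simpa using hw
  have borel_caratheodory : ∀ ε > 0,
      (R - dist z c) * ‖f z‖ ≤ ε * (2 * dist z c) + (R + dist z c) * ‖f c‖ := fun ε hε => by
    have h := Complex.borelCaratheodory (f := fun w => -f (c + w)) hε
      (hf.comp (by fun_prop) hadd).neg
      (fun w hw => by simpa using (neg_nonpos.2 (hre _ (hadd hw))).trans hε.le)
      (dist_nonneg.trans_lt hzR) (z := z - c) (by simpa [dist_eq_norm] using hz)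
    rw [norm_neg, norm_neg, add_sub_cancel, add_zero, ← dist_eq_norm, ← add_div,
      le_div_iff₀ (sub_pos.2 hzR)] at h
    linarith
  have hcont : Continuous fun ε : ℝ => ε * (2 * dist z c) + (R + dist z c) * ‖f c‖ := by fun_prop
  have hlim := (hcont.tendsto 0).mono_left (nhdsWithin_le_nhds (s := Set.Ioi 0))
  rw [zero_mul, zero_add] at hlim
  exact ge_of_tendsto hlim (eventually_mem_nhdsWithin.mono borel_caratheodory)

section Contraction

variable {M : Type*} [NormedAddCommGroup M] [InnerProductSpace ℂ M] {T : M →L[ℂ] M}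

theorem norm_sq_le_two_mul_re_inner (hT : ‖1 - T‖ ≤ 1) (g : M) :
    ‖T g‖ ^ 2 ≤ 2 * (inner ℂ g (T g)).re := by
  have contraction : ‖g - T g‖ ^ 2 ≤ ‖g‖ ^ 2 := by
    gcongr
    simpa using (1 - T).le_of_opNorm_le hT g
  rw [norm_sub_sq (𝕜 := ℂ), RCLike.re_to_complex] at contraction
  linarith

theorem norm_sq_le_mul_norm_inner {K : ℝ} (hT : ‖1 - T‖ ≤ 1) {g : M} (h : ‖g‖ ≤ K * ‖T g‖) :
    ‖g‖ ^ 2 ≤ 2 * K ^ 2 * ‖inner ℂ g (T g)‖ :=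
  calc ‖g‖ ^ 2 ≤ (K * ‖T g‖) ^ 2 := by gcongr
    _ = K ^ 2 * ‖T g‖ ^ 2 := mul_pow _ _ _
    _ ≤ K ^ 2 * (2 * ‖inner ℂ g (T g)‖) := by
      gcongr
      exact (norm_sq_le_two_mul_re_inner hT g).trans (by gcongr; exact Complex.re_le_norm _)
    _ = 2 * K ^ 2 * ‖inner ℂ g (T g)‖ := by ring

theorem isUnit_of_norm_sq_le_mul_norm_inner [CompleteSpace M] {C : ℝ} (hC : 0 < C)
    (h : ∀ g, ‖g‖ ^ 2 ≤ C * ‖inner ℂ g (T g)‖) : IsUnit T := by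
  refine ContinuousLinearMap.isUnit_of_forall_le_norm_inner_map T
    (c := C⁻¹.toNNReal) (Real.toNNReal_pos.2 (inv_pos.2 hC)) fun g => ?_
  rw [norm_inner_symm, Real.coe_toNNReal _ (inv_pos.2 hC).le, ← div_eq_mul_inv, div_le_iff₀' hC]
  exact h g

variable [CompleteSpace M] {N : ℂ → M →L[ℂ] M}

/-- Harnack's inequality bounds `⟪g, N a g⟫` by a multiple of `⟪g, N l g⟫` that does not depend
on `g`. -/
theorem isUnit_of_mem_ball {l a : ℂ} {R : ℝ} (hN : DifferentiableOn ℂ N (Metric.ball l R))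
    (hN_norm : ∀ w ∈ Metric.ball l R, ‖1 - N w‖ ≤ 1) (ha : a ∈ Metric.ball l R)
    (hNa : IsUnit (N a)) : IsUnit (N l) := by
  have haR : dist a l < R := ha
  have hR : 0 < R - dist a l := sub_pos.2 haR
  have hR' : 0 < R + dist a l := by linarith [dist_nonneg (x := a) (y := l)]
  obtain ⟨K, hK, bounded_below⟩ : ∃ K > 0, ∀ g, ‖g‖ ≤ K * ‖N a g‖ := by
    refine ⟨‖Ring.inverse (N a)‖ + 1, by positivity, fun g => ?_⟩
    calc ‖g‖ = ‖Ring.inverse (N a) (N a g)‖ := by rw [(ringInverse_apply_eq_iff hNa).2 rfl]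
      _ ≤ ‖Ring.inverse (N a)‖ * ‖N a g‖ := (Ring.inverse (N a)).le_opNorm _
      _ ≤ (‖Ring.inverse (N a)‖ + 1) * ‖N a g‖ := by gcongr; exact (lt_add_one _).le
  have harnack (g : M) : ‖inner ℂ g (N a g)‖ ≤
      (R + dist a l) / (R - dist a l) * ‖inner ℂ g (N l g)‖ := by
    rw [div_mul_eq_mul_div, le_div_iff₀' hR]
    refine mul_norm_le_mul_norm_center_of_re_nonneg (f := fun w => inner ℂ g (N w g))
      (fun w hw => ?_) (fun w hw => ?_) ha
    · exact ((innerSL ℂ g).comp (ContinuousLinearMap.apply ℂ M g)).differentiableAt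
        |>.comp_differentiableWithinAt w (hN w hw)
    · linarith [norm_sq_le_two_mul_re_inner (hN_norm w hw) g, sq_nonneg ‖N w g‖]
  refine isUnit_of_norm_sq_le_mul_norm_inner
    (C := 2 * K ^ 2 * ((R + dist a l) / (R - dist a l))) (by positivity) fun g => ?_
  calc ‖g‖ ^ 2 ≤ 2 * K ^ 2 * ‖inner ℂ g (N a g)‖ :=
        norm_sq_le_mul_norm_inner (hN_norm a ha) (bounded_below g)
    _ ≤ 2 * K ^ 2 * ((R + dist a l) / (R - dist a l) * ‖inner ℂ g (N l g)‖) := by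
        gcongr
        exact harnack g
    _ = _ := (mul_assoc _ _ _).symm

theorem isUnit_of_isPreconnected {U : Set ℂ} (hU : IsOpen U) (hU_conn : IsPreconnected U)
    (hN : DifferentiableOn ℂ N U) (hN_norm : ∀ w ∈ U, ‖1 - N w‖ ≤ 1) {a l : ℂ} (ha : a ∈ U)
    (hNa : IsUnit (N a)) (hl : l ∈ U) : IsUnit (N l) := by
  have hopen : IsOpen (U ∩ N ⁻¹' {T | IsUnit T}) :=
    hN.continuousOn.isOpen_inter_preimage hU Units.isOpen
  refine (hU_conn.subset_of_closure_inter_subset hopen ⟨a, ha, ha, hNa⟩ ?_ hl).2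
  rintro w ⟨hw, hwU⟩
  obtain ⟨R, hR, hball⟩ := Metric.isOpen_iff.1 hU w hwU
  obtain ⟨b, ⟨-, hNb⟩, hb⟩ := Metric.mem_closure_iff.1 hw R hR
  exact ⟨hwU, isUnit_of_mem_ball (hN.mono hball) (fun v hv => hN_norm v (hball hv))
    (Metric.mem_ball'.2 hb) hNb⟩

end Contraction

section Resolvent

variable {M : Type*} [NormedAddCommGroup M] [InnerProductSpace ℂ M] {A : LinRel M} {μ : ℂ}
  {F : M →L[ℂ] M}

theorem norm_add_conj_smul_le {f f' : M} (hμ : 0 ≤ μ.im) (h : 0 ≤ (inner ℂ f f').im) :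
    ‖f' + conj μ • f‖ ≤ ‖f' + μ • f‖ := by
  refine le_of_sq_le_sq ?_ (norm_nonneg _)
  rw [norm_add_sq (𝕜 := ℂ), norm_add_sq (𝕜 := ℂ), inner_smul_right, inner_smul_right, norm_smul,
    norm_smul, Complex.norm_conj, ← inner_conj_symm f' f]
  simp only [RCLike.re_to_complex, Complex.mul_re, Complex.conj_re, Complex.conj_im]
  nlinarith [mul_nonneg hμ h]

theorem apply_mem_of_shiftInv_eq_ofOp (hF : shiftInv A μ = ofOp F) (g : M) :
    (F g, g - μ • F g) ∈ A := by
  rw [(shiftInv_eq_ofOp_iff).1 hF, sub_add_cancel]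

theorem exists_norm_one_sub_smul_le_one (hμ : 0 < μ.im) :
    ∃ c : ℂ, c ≠ 0 ∧ ∀ {A : LinRel M} {F : M →L[ℂ] M}, shiftInv A μ = ofOp F →
      IsDissipative A → ‖1 - c • (1 + (1 - μ) • F)‖ ≤ 1 := by
  have hμ_conj : conj μ - 1 ≠ 0 := sub_ne_zero.2 fun h => by
    simpa [hμ.ne'] using congrArg Complex.im h
  have factor_norm : ‖(μ - 1) / (conj μ - 1)‖ = 1 := by
    rw [norm_div, ← Complex.norm_conj (μ - 1), map_sub, map_one,
      div_self (norm_ne_zero_iff.2 hμ_conj)]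
  refine ⟨(conj μ - μ) / (conj μ - 1), div_ne_zero (sub_ne_zero.2 fun h =>
    hμ.ne' (Complex.conj_eq_iff_im.1 h)) hμ_conj, fun {A F} hF hA => ?_⟩
  refine ContinuousLinearMap.opNorm_le_bound _ zero_le_one fun g => ?_
  -- Up to a factor of modulus one, the operator is the Cayley transform of `A` at `μ`.
  have eq_smul : (1 - ((conj μ - μ) / (conj μ - 1)) • (1 + (1 - μ) • F)) g =
      ((μ - 1) / (conj μ - 1)) • (g - μ • F g + conj μ • F g) := by
    simp only [sub_apply, smul_apply, add_apply, one_apply_eq_self]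
    match_scalars <;> field_simp <;> ring
  have cayley_le := norm_add_conj_smul_le hμ.le (hA _ (apply_mem_of_shiftInv_eq_ofOp hF g))
  rw [sub_add_cancel] at cayley_le
  rwa [eq_smul, norm_smul, factor_norm, one_mul, one_mul]

theorem norm_le_of_isNonneg (hF : shiftInv A μ = ofOp F) (hA : IsNonneg A) (g : M) :
    ‖g‖ ≤ (1 + ‖μ‖) * ‖(1 + (1 - μ) • F) g‖ := by
  obtain ⟨-, hre⟩ := hA _ (apply_mem_of_shiftInv_eq_ofOp hF g)
  have apply_eq : (1 + (1 - μ) • F) g = F g + (g - μ • F g) := by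
    simp only [add_apply, smul_apply, one_apply_eq_self]
    module
  have norm_sq := norm_add_sq (𝕜 := ℂ) (F g) (g - μ • F g)
  rw [← apply_eq, RCLike.re_to_complex] at norm_sq
  have fst_le : ‖F g‖ ≤ ‖(1 + (1 - μ) • F) g‖ :=
    le_of_sq_le_sq (by nlinarith [sq_nonneg ‖g - μ • F g‖]) (norm_nonneg _)
  have snd_le : ‖g - μ • F g‖ ≤ ‖(1 + (1 - μ) • F) g‖ :=
    le_of_sq_le_sq (by nlinarith [sq_nonneg ‖F g‖]) (norm_nonneg _)
  calc ‖g‖ = ‖g - μ • F g + μ • F g‖ := by rw [sub_add_cancel]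
    _ ≤ ‖g - μ • F g‖ + ‖μ‖ * ‖F g‖ := (norm_add_le _ _).trans_eq (by rw [norm_smul])
    _ ≤ ‖(1 + (1 - μ) • F) g‖ + ‖μ‖ * ‖(1 + (1 - μ) • F) g‖ := by gcongr
    _ = _ := by ring

theorem isUnit_one_add_smul_of_isNonneg [CompleteSpace M] (hμ : 0 < μ.im)
    (hF : shiftInv A μ = ofOp F) (hA : IsNonneg A) : IsUnit (1 + (1 - μ) • F) := by
  obtain ⟨c, hc, contraction⟩ := exists_norm_one_sub_smul_le_one (M := M) hμ
  rw [← isUnit_smul_iff (Units.mk0 c hc)]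
  refine isUnit_of_norm_sq_le_mul_norm_inner (T := c • (1 + (1 - μ) • F))
    (C := 2 * ((1 + ‖μ‖) / ‖c‖) ^ 2) (by positivity) fun g =>
      norm_sq_le_mul_norm_inner (contraction hF fun p hp => (hA p hp).1.ge) ?_
  calc ‖g‖ ≤ (1 + ‖μ‖) * ‖(1 + (1 - μ) • F) g‖ := norm_le_of_isNonneg hF hA g
    _ = (1 + ‖μ‖) / ‖c‖ * ‖(c • (1 + (1 - μ) • F)) g‖ := by
        rw [smul_apply, norm_smul, ← mul_assoc, div_mul_cancel₀ _ (norm_ne_zero_iff.2 hc)]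

end Resolvent

theorem exists_mem_upperHalf_of_eventually {P : ℂ → Prop} {l : ℂ} (hl : l ∈ negAxis)
    (h : ∀ᶠ w in 𝓝 l, P w) : ∃ w ∈ upperHalf, P w := by
  have hadd : Tendsto (fun t : ℝ => l + t * Complex.I) (𝓝[>] 0) (𝓝 l) := by
    have hcont : Continuous fun t : ℝ => l + t * Complex.I := by fun_prop
    simpa using (hcont.tendsto 0).mono_left nhdsWithin_le_nhds
  obtain ⟨t, hP, ht⟩ := ((hadd.eventually h).and self_mem_nhdsWithin).exists
  exact ⟨_, by simpa [upperHalf, hl.1] using ht, hP⟩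

section Existence

variable {M : Type*} [NormedAddCommGroup M] [InnerProductSpace ℂ M] [CompleteSpace M]
  {Q R : ℂ → LinRel M}

theorem IsStieltjesFamily.isUnit_one_add_smul (h : IsStieltjesFamily Q) {μ : ℂ}
    (hμ : μ ∈ upperHalf) {F : ℂ → M →L[ℂ] M} (hF : AnalyticOnNhd ℂ F (upperHalf ∪ negAxis))
    (hF_eq : ∀ l ∈ upperHalf ∪ negAxis, shiftInv (Q l) μ = ofOp (F l)) {l : ℂ}
    (hl : l ∈ upperHalf ∪ negAxis) : IsUnit (1 + (1 - μ) • F l) := by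
  have isUnit_of_negAxis : ∀ x ∈ negAxis, IsUnit (1 + (1 - μ) • F x) := fun x hx =>
    isUnit_one_add_smul_of_isNonneg hμ (hF_eq x (Or.inr hx)) (h.nonneg x hx)
  rcases hl with hl | hl
  · obtain ⟨c, hc, contraction⟩ := exists_norm_one_sub_smul_le_one (M := M) hμ
    have hN : AnalyticOnNhd ℂ (fun w => 1 + (1 - μ) • F w) (upperHalf ∪ negAxis) := fun w hw =>
      analyticAt_const.fun_add (analyticAt_const.fun_smul (hF w hw))
    have neg_one_mem : (-1 : ℂ) ∈ negAxis := by simp [negAxis]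
    obtain ⟨a, ha, hNa⟩ := exists_mem_upperHalf_of_eventually neg_one_mem
      ((hN (-1) (Or.inr neg_one_mem)).continuousAt.eventually
        (Units.isOpen.mem_nhds (isUnit_of_negAxis _ neg_one_mem)))
    rw [← isUnit_smul_iff (Units.mk0 c hc)] at hNa ⊢
    exact isUnit_of_isPreconnected (N := fun w => c • (1 + (1 - μ) • F w)) isOpen_upperHalf
      (convex_halfSpace_im_gt 0).isPreconnected
      ((hN.mono Set.subset_union_left).differentiableOn.const_smul c)
      (fun w hw => contraction (hF_eq w (Or.inl hw)) (h.nevanlinna.dissipative w hw).prop)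
      ha hNa hl
  · exact isUnit_of_negAxis l hl

theorem IsStieltjesFamily.exists_eq_cayley (h : IsStieltjesFamily Q) {l : ℂ} (hl : l ∈ cutPlane) :
    ∃ T : M →L[ℂ] M, Q l = cayley (ofOp T) := by
  obtain ⟨μ, hμ, F, hF, hF_eq⟩ := h.continuation_upper
  have upper : ∀ w ∈ upperHalf ∪ negAxis, ∃ T : M →L[ℂ] M, Q w = cayley (ofOp T) := fun w hw =>
    ⟨_, shiftInv_one_eq_ofOp_iff.1
      (shiftInv_eq_ofOp_of_isUnit (hF_eq w hw) (h.isUnit_one_add_smul hμ hF hF_eq hw))⟩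
  rcases mem_cutPlane_iff.1 hl with hl | hl | hl
  · exact upper l (Or.inl hl)
  · have hl_conj : conj l ∈ upperHalf := conj_mem_upperHalf_iff.2 hl
    obtain ⟨T, hT⟩ := upper _ (Or.inl hl_conj)
    refine ⟨ContinuousLinearMap.adjoint T, ?_⟩
    rw [← adjoint_ofOp, ← adjoint_cayley, ← hT, h.nevanlinna.adjoint_eq _ (ne_of_gt hl_conj),
      Complex.conj_conj]
  · exact upper l (Or.inr hl)

theorem IsStieltjesFamily.exists_isNevanlinnaSchur (h : IsStieltjesFamily Q) :
    ∃ Ω : ℂ → M →L[ℂ] M, IsNevanlinnaSchur Ω ∧ ∀ l ∈ cutPlane, Q l = stieltjesTransform Ω l := by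
  choose! T hT using fun l => h.exists_eq_cayley (l := l)
  have hQ : ∀ l ∈ cutPlane, Q l = cayley (ofOp (T (mobiusInv (mobius l)))) := fun l hl => by
    rw [mobiusInv_mobius (ne_one_of_mem_cutPlane hl)]
    exact hT l hl
  refine ⟨fun z => T (mobiusInv z), (h.isCutPlaneSchur hQ).isNevanlinnaSchur, fun l hl => ?_⟩
  rw [stieltjesTransform_eq_cayley]
  exact hQ l hl

theorem IsInverseStieltjesFamily.exists_isNevanlinnaSchur (h : IsInverseStieltjesFamily R) :
    ∃ Ω : ℂ → M →L[ℂ] M, IsNevanlinnaSchur Ω ∧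
      ∀ l ∈ cutPlane, R l = inverseStieltjesTransform Ω l := by
  obtain ⟨Ω, hΩ, hR⟩ := h.negInv.exists_isNevanlinnaSchur
  refine ⟨Ω, hΩ, fun l hl => ?_⟩
  rw [inverseStieltjesTransform_eq_negInv, ← hR l hl, negInv_negInv]

end Existence

theorem lemma3p2 {M : Type*} [NormedAddCommGroup M] [InnerProductSpace ℂ M] [CompleteSpace M] :
    (∀ Ω : ℂ → M →L[ℂ] M,
      (IsNevanlinnaSchur Ω ↔ IsStieltjesFamily (stieltjesTransform Ω)) ∧
      (IsNevanlinnaSchur Ω ↔ IsInverseStieltjesFamily (inverseStieltjesTransform Ω)) ∧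
      (∀ l ∈ cutPlane,
        (stieltjesTransform Ω l : Set (M × M)) =
            {p | ∃ h : M, p = ((1 - Ω ((1 + l) / (1 - l))) h, (1 + Ω ((1 + l) / (1 - l))) h)} ∧
        (inverseStieltjesTransform Ω l : Set (M × M)) =
            {p | ∃ h : M, p = ((1 + Ω ((1 + l) / (1 - l))) h, (Ω ((1 + l) / (1 - l)) - 1) h)} ∧
        inverseStieltjesTransform Ω l = LinRel.neg (LinRel.inv (stieltjesTransform Ω l)))) ∧
    (∀ Q : ℂ → LinRel M, IsStieltjesFamily Q →
      ∃ Ω : ℂ → M →L[ℂ] M, IsNevanlinnaSchur Ω ∧ ∀ l ∈ cutPlane, Q l = stieltjesTransform Ω l) ∧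
    (∀ R : ℂ → LinRel M, IsInverseStieltjesFamily R →
      ∃ Ω : ℂ → M →L[ℂ] M, IsNevanlinnaSchur Ω ∧
        ∀ l ∈ cutPlane, R l = inverseStieltjesTransform Ω l) ∧
    (∀ Q : ℂ → LinRel M, IsStieltjesFamily Q ↔
      IsInverseStieltjesFamily fun l => LinRel.neg (LinRel.inv (Q l))) := by
  refine ⟨fun Ω => ⟨isNevanlinnaSchur_iff_isStieltjesFamily,
    isNevanlinnaSchur_iff_isInverseStieltjesFamily, fun l _ => ⟨coe_stieltjesTransform Ω l,
      coe_inverseStieltjesTransform Ω l,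
      (inverseStieltjesTransform_eq_negInv Ω l).trans (negInv_eq_neg_inv _)⟩⟩,
    fun _ hQ => hQ.exists_isNevanlinnaSchur, fun _ hR => hR.exists_isNevanlinnaSchur, fun Q => ?_⟩
  simpa only [negInv_eq_neg_inv] using isStieltjesFamily_iff_isInverseStieltjesFamily_negInv
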